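/- Let $\mathcal X$ be a measurable space, let $\mathcal Y$ be a finite set of $c$ classes, and let $\mathcal D$ be a probability distribution on $\mathcal X\times\mathcal Y$. Let $L\colon\mathcal Y\times\mathcal Y\to\mathbb R_+$ be an arbitrary definite loss ($L(y,y')=0$ iff $y=y'$), with maximum $M=\max_{y,y'}L(y,y')$. Let $\Psi\colon\mathcal X\times\mathcal Y\to\mathbb R^N$ be a measurable feature map, $\Lambda_1,\Lambda_2\ge 0$, and for $p=1,2$ let $\mathcal H_p=\{(x,y)\mapsto w\cdot\Psi(x,y) : w\in\mathbb R^N,\ \|w\|_p\le\Lambda_p\}$. A scoring function $h$ defines a measurable predictor $\overline h$ with $\overline h(x)\in\operatorname{argmax}_{y\in\mathcal Y}h(x,y)$ (ties broken arbitrarily), and $R(h)=\mathbb E_{(x,y)\sim\mathcal D}[L(\overline h(x),y)]$. Fix $\rho>0$. For a sample $S=((x_1,y_1),\dots,(x_m,y_m))$ of size $m\ge 1$, and with $\Phi(r)=\min(M,\max(0,r))$, define $$\widehat R^{\mathrm{add}}_{S,\rho}(h)=\frac1m\sum_{i=1}^m\Phi\Big(\max_{y'\ne y_i}\Big\{L(y',y_i)-\tfrac1\rho\,[h(x_i,y_i)-h(x_i,y')]\Big\}\Big),$$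 $$\widehat R^{\mathrm{mult}}_{S,\rho}(h)=\frac1m\sum_{i=1}^m\Phi\Big(\max_{y'\ne y_i}L(y',y_i)\Big(1-\tfrac1\rho\,[h(x_i,y_i)-h(x_i,y')]\Big)\Big)$$ (an empty maximum, which occurs only for $c=1$, is read as $0$), and $r_\infty=\max_{i\le m,\,y\in\mathcal Y}\|\Psi(x_i,y)\|_\infty$, $r_2=\max_{i\le m,\,y\in\mathcal Y}\|\Psi(x_i,y)\|_2$. For any $\delta>0$, with probability at least $1-\delta$ over the draw of $S\sim\mathcal D^m$, the following two inequalities hold for all $h\in\mathcal H_1$: $$R(h)\le\widehat R^{\mathrm{add}}_{S,\rho}(h)+\frac{4\sqrt2\,\Lambda_1r_\infty}{\rho}\sqrt{\frac{c\log(2N)}{m}}+3M\sqrt{\frac{\log\frac2\delta}{2m}},$$ $$R(h)\le\widehat R^{\mathrm{mult}}_{S,\rho}(h)+\frac{4\sqrt2\,M\Lambda_1r_\infty}{\rho}\sqrt{\frac{c\log(2N)}{m}}+3M\sqrt{\frac{\log\frac2\delta}{2m}}.$$ Similarly, for any $\delta>0$, with probability at least $1-\delta$ over the draw of $S\sim\mathcal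 D^m$, the following two inequalities hold for all $h\in\mathcal H_2$: $$R(h)\le\widehat R^{\mathrm{add}}_{S,\rho}(h)+\frac{4\sqrt2\,\Lambda_2r_2}{\rho}\sqrt{\frac{c}{m}}+3M\sqrt{\frac{\log\frac2\delta}{2m}},$$ $$R(h)\le\widehat R^{\mathrm{mult}}_{S,\rho}(h)+\frac{4\sqrt2\,M\Lambda_2r_2}{\rho}\sqrt{\frac{c}{m}}+3M\sqrt{\frac{\log\frac2\delta}{2m}}.$$ -/

import Mathlib

open MeasureTheory
open scoped ENNReal

noncomputable section

/-- A definite loss: nonnegative, and zero exactly on the diagonal. -/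
structure IsDefiniteLoss {Y : Type*} (L : Y → Y → ℝ) : Prop where
  nonneg : ∀ y y', 0 ≤ L y y'
  eq_zero_iff : ∀ y y', L y y' = 0 ↔ y = y'

/-- The largest value `M = max_{y, y'} L(y, y')` of a loss on a finite set of classes. -/
def maxLoss {Y : Type*} (L : Y → Y → ℝ) : ℝ :=
  ⨆ p : Y × Y, L p.1 p.2

/-- The truncation `Φ(r) = min(M, max(0, r))`. -/
def clip (M r : ℝ) : ℝ := min M (max 0 r)

/-- `g` is a predictor defined by the scoring function `h`: for every `x`,
`g x` is a maximizer of `h x` over the classes (ties may be broken in any way). -/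
def IsPredictor {X Y : Type*} (h : X → Y → ℝ) (g : X → Y) : Prop :=
  ∀ x y, h x y ≤ h x (g x)

/-- The generalization error `E_{(x, y) ∼ D} [L(g(x), y)]` of a predictor `g`. -/
def genError {X Y : Type*} [MeasurableSpace X] [MeasurableSpace Y]
    (L : Y → Y → ℝ) (D : Measure (X × Y)) (g : X → Y) : ℝ :=
  ∫ z, L (g z.1) z.2 ∂D

/-- The empirical additive margin loss
`E_{(x, y) ∼ S} [Φ(max_{y' ≠ y} (L(y', y) - (h(x, y) - h(x, y')) / ρ))]`.
(If there is only one class the maximum is empty, `M = 0` and the loss is `0`.) -/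
def empAddMarginLoss {X Y : Type*} (L : Y → Y → ℝ) (ρ : ℝ) {m : ℕ}
    (S : Fin m → X × Y) (h : X → Y → ℝ) : ℝ :=
  (1 / (m : ℝ)) * ∑ i, clip (maxLoss L)
    (⨆ y' : {y' : Y // y' ≠ (S i).2},
      (L y' (S i).2 - (1 / ρ) * (h (S i).1 (S i).2 - h (S i).1 y')))

/-- The empirical multiplicative margin loss
`E_{(x, y) ∼ S} [Φ(max_{y' ≠ y} L(y', y) (1 - (h(x, y) - h(x, y')) / ρ))]`.
(If there is only one class the maximum is empty, `M = 0` and the loss is `0`.) -/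
def empMultMarginLoss {X Y : Type*} (L : Y → Y → ℝ) (ρ : ℝ) {m : ℕ}
    (S : Fin m → X × Y) (h : X → Y → ℝ) : ℝ :=
  (1 / (m : ℝ)) * ∑ i, clip (maxLoss L)
    (⨆ y' : {y' : Y // y' ≠ (S i).2},
      (L y' (S i).2 * (1 - (1 / ρ) * (h (S i).1 (S i).2 - h (S i).1 y'))))

/-- The linear hypothesis set `H_p`: the scoring functions `(x, y) ↦ w · Ψ(x, y)`
with `w ∈ ℝ^N` and `‖w‖_p ≤ Λ`. -/
def linHyp {X Y : Type*} {N : ℕ} (Ψ : X → Y → Fin N → ℝ) (p : ℝ≥0∞) (Λ : ℝ) :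
    Set (X → Y → ℝ) :=
  {h | ∃ w : Fin N → ℝ, ‖WithLp.toLp p w‖ ≤ Λ ∧ h = fun x y => ∑ j, w j * Ψ x y j}

/-- The data-dependent radius `r_q = max_{i, y} ‖Ψ(x_i, y)‖_q`, where `y` ranges over
all the classes. -/
def featRadius {X Y : Type*} {N : ℕ} (Ψ : X → Y → Fin N → ℝ) (q : ℝ≥0∞) {m : ℕ}
    (S : Fin m → X × Y) : ℝ :=
  ⨆ k : Fin m × Y, ‖WithLp.toLp q (Ψ (S k.1).1 k.2)‖

/-- With probability at least `1 - δ` over the draw of an i.i.d. sample `S` of size `m`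
from `D`, the property `A S` holds: `A` holds on a measurable event of probability at
least `1 - δ`. -/
def HoldsWithProb {Z : Type*} [MeasurableSpace Z] (D : Measure Z) (m : ℕ) (δ : ℝ)
    (A : (Fin m → Z) → Prop) : Prop :=
  ∃ E : Set (Fin m → Z), MeasurableSet E ∧
    ENNReal.ofReal (1 - δ) ≤ Measure.pi (fun _ : Fin m => D) E ∧ ∀ S ∈ E, A S

end

/-! At a maximizing class `k ≠ y` the margin `v y - v k` is at most `0`, so each clipped margin loss
dominates `L k y`. As a function of the score vector, the clipped loss is Lipschitz for the sup
norm, with constant `K = 2 / ρ` (additive) or `2 * maxLoss L / ρ` (multiplicative). It therefore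
suffices to bound the mean of the margin loss by its empirical mean, uniformly over the weights.

For a finite family with values in `[0, M]`, let `G` be the supremum of the summed deviations and
`R` the empirical Rademacher average. Symmetrization gives mean at most `0` to `G - 2 * R`, and
changing one sample point moves it by at most `3 * M`. A single application of McDiarmid's
inequality then gives the term `3 * M * √(log (1 / δ) / (2 * m))`. Applying this at `δ / 2` to each
of the two losses produces `log (2 / δ)`.

Vector contraction (`expect_ciSup_sum_sign_le`) replaces `R` by `K` times an average with one sign
for each pair of a sample point and a class. The sup norm of a vector is at most the mean modulus of
its Rademacher sum, so no constant is lost. Duality then removes the weights: the `m * c` signs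
leave the sup norm of a random vector (Massart's lemma) or its Euclidean norm (second moment),
whence the factor `√c`.

Only finite families are treated up to this point, which keeps suprema measurable. The full class
follows from a dense sequence of weights and continuity. -/

/-! ### Bounded measurable functions and integration over product samples -/

section BddMeas

/-- A bounded measurable real function. -/
structure BddMeas {α : Type*} [MeasurableSpace α] (F : α → ℝ) : Prop where
  measurable : Measurable F
  bounded : ∃ B, ∀ x, |F x| ≤ B

theorem abs_ciSup_le_of_forall {ι : Type*} [Finite ι] [Nonempty ι] {a : ι → ℝ} {B : ℝ}
    (h : ∀ i, |a i| ≤ B) : |⨆ i, a i| ≤ B := by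
  obtain ⟨i₀⟩ := ‹Nonempty ι›
  rw [abs_le]
  exact ⟨(abs_le.1 (h i₀)).1.trans (le_ciSup (Set.finite_range a).bddAbove i₀),
    ciSup_le fun i => (abs_le.1 (h i)).2⟩

namespace BddMeas

variable {α β : Type*} [MeasurableSpace α] [MeasurableSpace β] {F G : α → ℝ}

theorem const (a : ℝ) : BddMeas fun _ : α => a := ⟨measurable_const, |a|, fun _ => le_rfl⟩

theorem add (hF : BddMeas F) (hG : BddMeas G) : BddMeas fun x => F x + G x := by
  obtain ⟨B, hB⟩ := hF.bounded
  obtain ⟨C, hC⟩ := hG.bounded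
  exact ⟨hF.measurable.add hG.measurable, B + C, fun x =>
    (abs_add_le _ _).trans (add_le_add (hB x) (hC x))⟩

theorem const_mul (hF : BddMeas F) (a : ℝ) : BddMeas fun x => a * F x := by
  obtain ⟨B, hB⟩ := hF.bounded
  exact ⟨hF.measurable.const_mul a, |a| * B, fun x => by
    rw [abs_mul]; exact mul_le_mul_of_nonneg_left (hB x) (abs_nonneg a)⟩

theorem sub (hF : BddMeas F) (hG : BddMeas G) : BddMeas fun x => F x - G x := by
  simpa [sub_eq_add_neg] using hF.add (hG.const_mul (-1))

theorem sum {ι : Type*} (s : Finset ι) {F : ι → α → ℝ} (hF : ∀ i, BddMeas (F i)) :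
    BddMeas fun x => ∑ i ∈ s, F i x := by
  choose B hB using fun i => (hF i).bounded
  exact ⟨Finset.measurable_fun_sum s fun i _ => (hF i).measurable, ∑ i ∈ s, B i, fun x =>
    (Finset.abs_sum_le_sum_abs _ _).trans (Finset.sum_le_sum fun i _ => hB i x)⟩

theorem expect {ι : Type*} [Fintype ι] {F : ι → α → ℝ} (hF : ∀ i, BddMeas (F i)) :
    BddMeas fun x => Finset.expect Finset.univ fun i => F i x := by
  simp only [Fintype.expect_eq_sum_div_card, div_eq_inv_mul]
  exact (sum _ hF).const_mul _

theorem iSup {ι : Type*} [Finite ι] [Nonempty ι] {F : ι → α → ℝ} (hF : ∀ i, BddMeas (F i)) :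
    BddMeas fun x => ⨆ i, F i x := by
  choose B hB using fun i => (hF i).bounded
  exact ⟨Measurable.iSup fun i => (hF i).measurable, ⨆ i, B i, fun x =>
    abs_ciSup_le_of_forall fun i => (hB i x).trans (le_ciSup (Set.finite_range B).bddAbove i)⟩

theorem comp (hF : BddMeas F) {g : β → α} (hg : Measurable g) : BddMeas fun x => F (g x) :=
  ⟨hF.measurable.comp hg, hF.bounded.imp fun _ hB x => hB (g x)⟩

theorem exp (hF : BddMeas F) : BddMeas fun x => Real.exp (F x) := by
  obtain ⟨B, hB⟩ := hF.bounded
  refine ⟨hF.measurable.exp, Real.exp B, fun x => ?_⟩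
  rw [abs_of_pos (Real.exp_pos _)]
  exact Real.exp_le_exp.2 (abs_le.1 (hB x)).2

theorem integrable (hF : BddMeas F) (μ : Measure α) [IsFiniteMeasure μ] : Integrable F μ := by
  obtain ⟨B, hB⟩ := hF.bounded
  exact Integrable.of_bound hF.measurable.aestronglyMeasurable B (ae_of_all _ hB)

theorem integral_right {F : α → β → ℝ} (hF : BddMeas fun p : α × β => F p.1 p.2) (μ : Measure β)
    [IsProbabilityMeasure μ] : BddMeas fun x => ∫ y, F x y ∂μ := by
  obtain ⟨B, hB⟩ := hF.bounded
  refine ⟨(hF.measurable.stronglyMeasurable.integral_prod_right).measurable, B, fun x => ?_⟩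
  simpa using norm_integral_le_of_norm_le_const (μ := μ) (f := fun y => F x y)
    (ae_of_all _ fun y => hB (x, y))

theorem integral_left {F : α → β → ℝ} (hF : BddMeas fun p : α × β => F p.1 p.2) (μ : Measure α)
    [IsProbabilityMeasure μ] : BddMeas fun y => ∫ x, F x y ∂μ :=
  integral_right (F := fun y x => F x y) (hF.comp measurable_swap) μ

end BddMeas

theorem integral_expect {α ι : Type*} [MeasurableSpace α] [Fintype ι] {F : ι → α → ℝ}
    (hF : ∀ i, BddMeas (F i)) (μ : Measure α) [IsFiniteMeasure μ] :
    ∫ x, Finset.expect Finset.univ (fun i => F i x) ∂μ =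
      Finset.expect Finset.univ fun i => ∫ x, F i x ∂μ := by
  simp only [Fintype.expect_eq_sum_div_card, integral_div]
  rw [integral_finsetSum _ fun i _ => (hF i).integrable μ]

theorem measurable_fin_cons {Z : Type*} [MeasurableSpace Z] {m : ℕ} :
    Measurable fun p : Z × (Fin m → Z) => (Fin.cons p.1 p.2 : Fin (m + 1) → Z) := by
  refine measurable_pi_lambda _ fun i => ?_
  refine Fin.cases ?_ (fun j => ?_) i
  · simpa using measurable_fst
  · exact (measurable_pi_apply j).comp measurable_snd

theorem BddMeas.fin_cons {Z : Type*} [MeasurableSpace Z] {m : ℕ} {F : (Fin (m + 1) → Z) → ℝ}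
    (hF : BddMeas F) : BddMeas fun p : Z × (Fin m → Z) => F (Fin.cons p.1 p.2) :=
  hF.comp measurable_fin_cons

theorem integral_pi_fin_succ {Z : Type*} [MeasurableSpace Z] (D : Measure Z)
    [IsProbabilityMeasure D] {m : ℕ} {F : (Fin (m + 1) → Z) → ℝ} (hF : BddMeas F) :
    ∫ S, F S ∂Measure.pi (fun _ => D) =
      ∫ z, ∫ S, F (Fin.cons z S) ∂Measure.pi (fun _ : Fin m => D) ∂D := by
  rw [← ((measurePreserving_piFinSuccAbove (fun _ : Fin (m + 1) => D) 0).symm).integral_comp']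
  rw [← integral_prod _ (hF.fin_cons.integrable _)]
  simp [MeasurableEquiv.piFinSuccAbove_symm_apply, Fin.insertNthEquiv]

end BddMeas

/-! ### McDiarmid's inequality -/

section McDiarmid

open ProbabilityTheory

theorem BddMeas.exists_mem_Icc {Z : Type*} [MeasurableSpace Z] [Nonempty Z] {V : Z → ℝ}
    (hV : BddMeas V) {c : ℝ} (hc : ∀ z z', V z - V z' ≤ c) : ∃ a, ∀ z, V z ∈ Set.Icc a (a + c) := by
  obtain ⟨B, hB⟩ := hV.bounded
  have hbdd : BddBelow (Set.range V) := ⟨-B, by rintro _ ⟨z, rfl⟩; exact (abs_le.1 (hB z)).1⟩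
  refine ⟨⨅ z, V z, fun z => ⟨ciInf_le hbdd z, ?_⟩⟩
  have : V z - c ≤ ⨅ z, V z := le_ciInf fun z' => by linarith [hc z z']
  linarith

/-- **McDiarmid's inequality**: a bounded function of `m` independent variables that changes by at
most `c` when one variable is changed is sub-Gaussian with variance proxy `m (c / 2) ^ 2`. -/
theorem hasSubgaussianMGF_of_bounded_differences {Z : Type*} [MeasurableSpace Z] (D : Measure Z)
    [IsProbabilityMeasure D] (c : NNReal) {m : ℕ} {F : (Fin m → Z) → ℝ} (hF : BddMeas F)
    (hc : ∀ S i z, F (Function.update S i z) - F S ≤ c) :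
    HasSubgaussianMGF (fun S => F S - ∫ S', F S' ∂Measure.pi (fun _ => D)) (m * (c / 2) ^ 2)
      (Measure.pi fun _ => D) := by
  have hint : ∀ (t a : ℝ) {n : ℕ} {G : (Fin n → Z) → ℝ}, BddMeas G →
      BddMeas fun S => Real.exp (t * (G S - a)) := fun t a n G hG =>
    ((hG.sub (BddMeas.const a)).const_mul t).exp
  refine ⟨fun t => (hint t _ hF).integrable _, fun t => ?_⟩
  rw [mgf]
  have hZ : Nonempty Z := nonempty_of_isProbabilityMeasure D
  induction m with
  | zero =>
    have : ∀ S : Fin 0 → Z, F S = F ![] := fun S => congrArg F (Subsingleton.elim _ _)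
    simp [this]
  | succ m ih =>
    -- `V` is the conditional mean given the first coordinate. It inherits oscillation at most `c`,
    -- so Hoeffding's lemma applies to it, while the induction hypothesis handles the fluctuation of
    -- `F` around `V z` for fixed `z`.
    set V : Z → ℝ := fun z => ∫ S, F (Fin.cons z S) ∂Measure.pi (fun _ : Fin m => D) with hVdef
    have hV : BddMeas V := BddMeas.integral_right hF.fin_cons _
    have hsec : ∀ z, BddMeas fun S : Fin m → Z => F (Fin.cons z S) := fun z =>
      hF.fin_cons.comp measurable_prodMk_left
    have hVc : ∀ z z', V z - V z' ≤ c := fun z z' => by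
      rw [hVdef]
      simp only
      rw [← integral_sub ((hsec z).integrable _) ((hsec z').integrable _)]
      refine (integral_mono (((hsec z).sub (hsec z')).integrable _) (integrable_const (c : ℝ))
        fun S => ?_).trans (by simp)
      have := hc (Fin.cons z' S) 0 z
      rwa [Fin.update_cons_zero] at this
    obtain ⟨a, ha⟩ := hV.exists_mem_Icc hVc
    have hoeff := (hasSubgaussianMGF_of_mem_Icc hV.measurable.aemeasurable
      (ae_of_all D ha)).mgf_le t
    rw [mgf] at hoeff
    rw [integral_pi_fin_succ D hF, integral_pi_fin_succ D (hint t _ hF)]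
    have hstep : ∀ z, ∫ S, Real.exp (t * (F (Fin.cons z S) - ∫ z, V z ∂D))
        ∂Measure.pi (fun _ : Fin m => D) ≤
        Real.exp (((m * (c / 2) ^ 2 : NNReal) : ℝ) * t ^ 2 / 2) *
          Real.exp (t * (V z - ∫ z, V z ∂D)) := fun z => by
      have := ih (hsec z) fun S i z' => by
        have := hc (Fin.cons z S) i.succ z'
        rwa [← Fin.cons_update] at this
      refine le_trans (le_of_eq ?_) (mul_le_mul_of_nonneg_right this (Real.exp_pos _).le)
      rw [← integral_mul_const]
      refine integral_congr_ae (ae_of_all _ fun S => ?_)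
      simp only
      rw [← Real.exp_add]
      congr 1
      ring
    have hVe : BddMeas fun z => Real.exp (t * (V z - ∫ z, V z ∂D)) :=
      ((hV.sub (BddMeas.const _)).const_mul t).exp
    calc _ ≤ ∫ z, Real.exp (((m * (c / 2) ^ 2 : NNReal) : ℝ) * t ^ 2 / 2) *
          Real.exp (t * (V z - ∫ z, V z ∂D)) ∂D :=
          integral_mono ((BddMeas.integral_right
            (hint t (∫ z, V z ∂D) hF).fin_cons _).integrable D)
            ((hVe.const_mul _).integrable D) hstep
      _ ≤ _ := by
          rw [integral_const_mul]
          refine (mul_le_mul_of_nonneg_left hoeff (Real.exp_pos _).le).trans (le_of_eq ?_)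
          rw [← Real.exp_add]
          congr 1
          simp
          ring

end McDiarmid

/-! ### Rademacher averages: contraction, Massart's lemma, second moments -/

section SignAverages

open Finset
open scoped BigOperators

/-- The sign encoded by a Boolean. -/
def boolSign (b : Bool) : ℝ := if b then 1 else -1

@[simp] theorem boolSign_true : boolSign true = 1 := rfl

@[simp] theorem boolSign_false : boolSign false = -1 := rfl

@[simp] theorem boolSign_not (b : Bool) : boolSign (!b) = -boolSign b := by cases b <;> simp

@[simp] theorem boolSign_mul_self (b : Bool) : boolSign b * boolSign b = 1 := by cases b <;> simp

@[simp] theorem abs_boolSign (b : Bool) : |boolSign b| = 1 := by cases b <;> simp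

theorem expect_bool (f : Bool → ℝ) : 𝔼 b, f b = (f true + f false) / 2 := by
  rw [Fintype.expect_eq_sum_div_card]
  simp

theorem expect_fin_succ {T : Type*} [Fintype T] {n : ℕ} (F : (Fin (n + 1) → T) → ℝ) :
    𝔼 σ, F σ = 𝔼 t, 𝔼 σ, F (Fin.cons t σ) := by
  rw [← Finset.expect_product' univ univ fun (t : T) (σ : Fin n → T) => F (Fin.cons t σ),
    univ_product_univ]
  exact (Fintype.expect_equiv (Fin.consEquiv fun _ => T) _ _ fun _ => rfl).symm

theorem le_ciSup_of_finite {ι : Type*} [Finite ι] (a : ι → ℝ) (i : ι) : a i ≤ ⨆ j, a j :=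
  le_ciSup (Set.finite_range a).bddAbove i

theorem expect_not_comp {κ : Type*} [Fintype κ] [DecidableEq κ] (G : (κ → Bool) → ℝ) :
    𝔼 ε : κ → Bool, G (fun k => !ε k) = 𝔼 ε, G ε :=
  Fintype.expect_equiv (Equiv.piCongrRight fun _ => Equiv.boolNot) _ _ fun _ => rfl

/-- Any coordinate of a vector is dominated by the mean absolute value of its Rademacher sum. -/
theorem abs_le_expect_abs_sum {κ : Type*} [Fintype κ] [DecidableEq κ] (d : κ → ℝ) (k₀ : κ) :
    |d k₀| ≤ 𝔼 ε : κ → Bool, |∑ k, boolSign (ε k) * d k| := by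
  -- `e` flips every sign but the one at `k₀`. The signed sums at `ε` and `e ε` add up to `±2 * d
  -- k₀`, and `e` preserves the average.
  let e : (κ → Bool) ≃ (κ → Bool) :=
    Equiv.piCongrRight fun k => if k = k₀ then Equiv.refl _ else Equiv.boolNot
  have he : 𝔼 ε : κ → Bool, |∑ k, boolSign (e ε k) * d k| =
      𝔼 ε : κ → Bool, |∑ k, boolSign (ε k) * d k| :=
    Fintype.expect_equiv e _ _ fun _ => rfl
  have hpt : ∀ ε : κ → Bool, 2 * |d k₀| ≤
      |∑ k, boolSign (ε k) * d k| + |∑ k, boolSign (e ε k) * d k| := fun ε => by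
    refine le_trans (le_of_eq ?_) (abs_add_le _ _)
    rw [← sum_add_distrib, sum_eq_single k₀]
    · have : e ε k₀ = ε k₀ := by simp [e]
      rw [this, ← two_mul, abs_mul, abs_mul]
      simp
    · intro k _ hk
      have : e ε k = !ε k := by simp [e, hk]
      rw [this]
      simp
    · simp
  have := expect_le_expect (s := univ) fun ε (_ : ε ∈ (univ : Finset (κ → Bool))) => hpt ε
  rw [expect_add_distrib, he, Fintype.expect_const] at this
  linarith

/-- One step of contraction. The two values of `b` yield two independent choices `h`, `h'` and the
difference `f h - f h'`. By `hf` this is at most a mean of moduli, and each modulus is realized by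
assigning `h` and `h'` to the opposite sign patterns `ε` and `!ε` in the better order. The offset
`A` carries the other terms when the step is iterated. -/
theorem expect_ciSup_sign_le {ι κ : Type*} [Finite ι] [Nonempty ι] [Fintype κ] [DecidableEq κ]
    (f : ι → ℝ) (u : κ → ι → ℝ) {K : ℝ}
    (hf : ∀ h h', f h - f h' ≤ K * 𝔼 ε : κ → Bool, |∑ k, boolSign (ε k) * (u k h - u k h')|)
    (A : ι → ℝ) :
    𝔼 b, ⨆ h, (A h + boolSign b * f h) ≤
      𝔼 ε : κ → Bool, ⨆ h, (A h + K * ∑ k, boolSign (ε k) * u k h) := by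
  set G : (κ → Bool) → ℝ := fun ε => ⨆ h, (A h + K * ∑ k, boolSign (ε k) * u k h) with hG
  have hGle : ∀ (ε : κ → Bool) h, A h + K * ∑ k, boolSign (ε k) * u k h ≤ G ε := fun ε h =>
    le_ciSup_of_finite (fun h => A h + K * ∑ k, boolSign (ε k) * u k h) h
  have hGnot : ∀ (ε : κ → Bool) h, A h - K * ∑ k, boolSign (ε k) * u k h ≤ G (fun k => !ε k) := fun ε h => by
    refine le_trans (le_of_eq ?_) (hGle (fun k => !ε k) h)
    simp [sub_eq_add_neg]
  have hpair : ∀ h h', A h + f h + (A h' - f h') ≤ 2 * 𝔼 ε, G ε := fun h h' => by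
    have hpt : ∀ ε : κ → Bool, A h + A h' + K * |∑ k, boolSign (ε k) * (u k h - u k h')| ≤
        G ε + G (fun k => !ε k) := fun ε => by
      have hs : ∑ k, boolSign (ε k) * (u k h - u k h') =
          ∑ k, boolSign (ε k) * u k h - ∑ k, boolSign (ε k) * u k h' := by
        rw [← sum_sub_distrib]
        exact sum_congr rfl fun k _ => mul_sub _ _ _
      rw [hs]
      rcases abs_cases (∑ k, boolSign (ε k) * u k h - ∑ k, boolSign (ε k) * u k h') with h1 | h1
      · rw [h1.1]; linarith [hGle ε h, hGnot ε h']
      · rw [h1.1]; linarith [hGle ε h', hGnot ε h]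
    have := expect_le_expect (s := univ) fun ε (_ : ε ∈ (univ : Finset (κ → Bool))) => hpt ε
    simp only [expect_add_distrib, Fintype.expect_const, ← mul_expect] at this
    rw [expect_not_comp G] at this
    linarith [hf h h']
  rw [expect_bool]
  simp only [boolSign_true, boolSign_false, one_mul, neg_mul, ← sub_eq_add_neg]
  have h1 : ∀ h', ⨆ h, (A h + f h) ≤ 2 * 𝔼 ε, G ε - (A h' - f h') := fun h' =>
    ciSup_le fun h => by linarith [hpair h h']
  have h2 : ⨆ h, (A h - f h) ≤ 2 * 𝔼 ε, G ε - ⨆ h, (A h + f h) :=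
    ciSup_le fun h => by linarith [h1 h]
  linarith

/-- **Vector contraction** for Rademacher averages. -/
theorem expect_ciSup_sum_sign_le {ι κ : Type*} [Finite ι] [Nonempty ι] [Fintype κ]
    [DecidableEq κ] {n : ℕ} (f : Fin n → ι → ℝ) (u : Fin n → κ → ι → ℝ) {K : ℝ}
    (hf : ∀ i h h', f i h - f i h' ≤
      K * 𝔼 ε : κ → Bool, |∑ k, boolSign (ε k) * (u i k h - u i k h')|)
    (A : ι → ℝ) :
    𝔼 σ : Fin n → Bool, ⨆ h, (A h + ∑ i, boolSign (σ i) * f i h) ≤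
      𝔼 ε : Fin n → κ → Bool, ⨆ h, (A h + K * ∑ i, ∑ k, boolSign (ε i k) * u i k h) := by
  induction n generalizing A with
  | zero => simp
  | succ n ih =>
    have ih' := ih (fun i => f i.succ) (fun i => u i.succ) fun i => hf i.succ
    rw [expect_fin_succ, expect_fin_succ]
    simp only [Fin.sum_univ_succ, Fin.cons_zero, Fin.cons_succ, mul_add, ← add_assoc]
    have hih := expect_le_expect (s := univ) fun b (_ : b ∈ (univ : Finset Bool)) =>
      ih' fun h => A h + boolSign b * f 0 h
    refine hih.trans ?_
    -- With the later signs frozen, their contribution becomes part of the offset, and the one-step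
    -- contraction replaces the first sign.
    rw [expect_comm]
    refine le_trans ?_ (le_of_eq (expect_comm _ _ _))
    apply expect_le_expect
    intro ε _
    have := expect_ciSup_sign_le (f 0) (u 0) (hf 0)
      fun h => A h + K * ∑ i, ∑ k, boolSign (ε i k) * u i.succ k h
    simpa only [add_right_comm] using this

theorem expect_curry {n : ℕ} {κ : Type*} [Fintype κ] [DecidableEq κ]
    (F : (Fin n × κ → Bool) → ℝ) :
    𝔼 ε : Fin n → κ → Bool, F (fun p => ε p.1 p.2) = 𝔼 ε, F ε :=
  Fintype.expect_equiv (Equiv.curry (Fin n) κ Bool).symm _ _ fun _ => rfl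

/-- Independence factors the exponential moment into `∏ cosh (v a)`, and `cosh x ≤ exp (x ^ 2 / 2)`.
-/
theorem expect_exp_sum_sign_le {I : Type*} [Fintype I] [DecidableEq I] (v : I → ℝ) :
    𝔼 ε : I → Bool, Real.exp (∑ a, boolSign (ε a) * v a) ≤ Real.exp ((∑ a, v a ^ 2) / 2) := by
  have h := Finset.prod_univ_sum (fun _ : I => (univ : Finset Bool))
    fun a b => Real.exp (boolSign b * v a)
  rw [Fintype.piFinset_univ] at h
  simp only [Real.exp_sum]
  rw [Fintype.expect_eq_sum_div_card, ← h, Fintype.card_fun, Fintype.card_bool]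
  have h2 : ∀ a, ∑ b, Real.exp (boolSign b * v a) = 2 * Real.cosh (v a) := fun a => by
    rw [Real.cosh_eq]
    simp
    ring
  simp only [h2, prod_mul_distrib, prod_const, Finset.card_univ]
  rw [sum_div, Real.exp_sum]
  push_cast
  rw [mul_div_cancel_left₀ _ (by positivity)]
  exact prod_le_prod (fun a _ => (Real.cosh_pos _).le) fun a _ => Real.cosh_le_exp_half_sq _

/-- **Massart's lemma** for the sup norm of a Rademacher sum in `ℝ ^ N`. -/
theorem expect_le_sqrt_of_abs_le {I : Type*} [Fintype I] [DecidableEq I] {N : ℕ}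
    (v : I → Fin N → ℝ) {r : ℝ} (hr : 0 ≤ r) (hv : ∀ a j, |v a j| ≤ r) (hN : 0 < N)
    (X : (I → Bool) → ℝ) (hX : ∀ ε, ∃ j, X ε ≤ |∑ a, boolSign (ε a) * v a j|) :
    𝔼 ε, X ε ≤ r * √(2 * Fintype.card I * Real.log (2 * N)) := by
  set n : ℝ := ((Fintype.card I : ℕ) : ℝ) with hn
  have hl : 0 < Real.log (2 * N) := Real.log_pos (by
    have : (1 : ℝ) ≤ N := by exact_mod_cast hN
    linarith)
  have key : ∀ t : ℝ, 0 < t → t * 𝔼 ε, X ε ≤ Real.log (2 * N) + n * (t * r) ^ 2 / 2 := by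
    intro t ht
    -- The tangent bound `x - b + 1 ≤ exp (x - b)` replaces Jensen's inequality. This `b` is chosen
    -- so that `exp (-b)` times the bound on the total of the `2 * N` exponential moments is exactly
    -- `1`.
    set b := Real.log (2 * N) + n * (t * r) ^ 2 / 2 with hb
    have hpt : ∀ ε : I → Bool, t * X ε ≤ Real.exp (-b) *
        ∑ j, (Real.exp (∑ a, boolSign (ε a) * (t * v a j)) +
          Real.exp (∑ a, boolSign (ε a) * (-(t * v a j)))) - 1 + b := by
      intro ε
      obtain ⟨j, hj⟩ := hX ε
      have h1 : t * X ε - b + 1 ≤ Real.exp (t * X ε - b) := Real.add_one_le_exp _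
      have hs : ∑ a, boolSign (ε a) * (t * v a j) = t * ∑ a, boolSign (ε a) * v a j := by
        rw [mul_sum]
        exact sum_congr rfl fun a _ => by ring
      have hs' : ∑ a, boolSign (ε a) * (-(t * v a j)) = -(t * ∑ a, boolSign (ε a) * v a j) := by
        rw [← hs, ← sum_neg_distrib]
        exact sum_congr rfl fun a _ => by ring
      have h2 : Real.exp (t * X ε) ≤ Real.exp (∑ a, boolSign (ε a) * (t * v a j)) +
          Real.exp (∑ a, boolSign (ε a) * (-(t * v a j))) := by
        rw [hs, hs']
        have h3 := mul_le_mul_of_nonneg_left hj ht.le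
        rcases abs_cases (∑ a, boolSign (ε a) * v a j) with hc | hc <;> rw [hc.1] at h3
        · exact (Real.exp_le_exp.2 h3).trans (le_add_of_nonneg_right (Real.exp_pos _).le)
        · rw [mul_neg] at h3
          exact (Real.exp_le_exp.2 h3).trans (le_add_of_nonneg_left (Real.exp_pos _).le)
      have h4 := h2.trans (single_le_sum (f := fun j =>
        Real.exp (∑ a, boolSign (ε a) * (t * v a j)) +
          Real.exp (∑ a, boolSign (ε a) * (-(t * v a j))))
        (fun j _ => by positivity) (mem_univ j))
      have h5 := mul_le_mul_of_nonneg_left h4 (Real.exp_pos (-b)).le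
      rw [← Real.exp_add, neg_add_eq_sub] at h5
      linarith
    have hsum := expect_le_expect (s := univ) fun ε (_ : ε ∈ (univ : Finset (I → Bool))) => hpt ε
    rw [← mul_expect, expect_add_distrib, expect_sub_distrib, Fintype.expect_const,
      Fintype.expect_const, ← mul_expect, expect_sum_comm] at hsum
    have hj : ∀ j, 𝔼 ε : I → Bool, (Real.exp (∑ a, boolSign (ε a) * (t * v a j)) +
        Real.exp (∑ a, boolSign (ε a) * (-(t * v a j)))) ≤ 2 * Real.exp (n * (t * r) ^ 2 / 2) := by
      intro j
      have hsq : (∑ a, (t * v a j) ^ 2) ≤ n * (t * r) ^ 2 := by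
        refine (sum_le_card_nsmul univ _ ((t * r) ^ 2) fun a _ => ?_).trans (by simp [hn])
        rw [sq_le_sq, abs_mul, abs_mul, abs_of_nonneg hr]
        exact mul_le_mul_of_nonneg_left (hv a j) (abs_nonneg t)
      rw [expect_add_distrib, two_mul]
      refine add_le_add ((expect_exp_sum_sign_le _).trans ?_)
        ((expect_exp_sum_sign_le _).trans ?_) <;> apply Real.exp_le_exp.2
      · linarith
      · simp only [neg_sq]; linarith
    have hall := sum_le_sum fun j (_ : j ∈ (univ : Finset (Fin N))) => hj j
    have hexp : Real.exp (-b) * ∑ _j : Fin N, 2 * Real.exp (n * (t * r) ^ 2 / 2) = 1 := by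
      have hN' : (0 : ℝ) < 2 * N := by positivity
      rw [hb, neg_add, Real.exp_add, Real.exp_neg, Real.exp_log hN', Real.exp_neg]
      simp only [sum_const, Finset.card_univ, Fintype.card_fin, nsmul_eq_mul]
      field_simp
    have := mul_le_mul_of_nonneg_left hall (Real.exp_pos (-b)).le
    linarith
  -- If `n * r ^ 2 = 0` there is no optimal `t`, and letting `t` grow gives a mean at most `0`.
  -- Otherwise `t = s / (n * r)` balances the two terms of `key`.
  rcases eq_or_lt_of_le (mul_nonneg (Nat.cast_nonneg (Fintype.card I) : (0 : ℝ) ≤ n) (sq_nonneg r))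
    with h0 | hpos
  · have hle : ∀ t : ℝ, 0 < t → t * 𝔼 ε, X ε ≤ Real.log (2 * N) := fun t ht => by
      have := key t ht
      have h : n * (t * r) ^ 2 = 0 := by rw [mul_pow, mul_left_comm, ← h0, mul_zero]
      rw [h] at this
      linarith
    have : 𝔼 ε, X ε ≤ 0 := by
      by_contra! hc
      have := hle (2 * Real.log (2 * N) / 𝔼 ε, X ε) (by positivity)
      rw [div_mul_cancel₀ _ hc.ne'] at this
      linarith
    exact this.trans (by positivity)
  · have hr0 : 0 < r := lt_of_le_of_ne hr fun h => by simp [← h] at hpos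
    have hn0 : 0 < n := pos_of_mul_pos_left hpos (sq_nonneg r)
    set s := √(2 * n * Real.log (2 * N)) with hs
    have hs0 : 0 < s := Real.sqrt_pos.2 (by positivity)
    have hss : s ^ 2 = 2 * n * Real.log (2 * N) := Real.sq_sqrt (by positivity)
    have := key (s / (n * r)) (by positivity)
    have e : Real.log (2 * N) + n * (s / (n * r) * r) ^ 2 / 2 = s / (n * r) * (r * s) := by
      have : Real.log (2 * N) = s ^ 2 / (2 * n) := by rw [hss]; field_simp
      rw [this]
      field_simp
      ring
    rw [e] at this
    exact le_of_mul_le_mul_left this (by positivity)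

/-- For `a ≠ b`, flipping the sign at `a` alone negates the product and preserves the average. -/
theorem expect_sign_mul_sign {I : Type*} [Fintype I] [DecidableEq I] (a b : I) :
    𝔼 ε : I → Bool, boolSign (ε a) * boolSign (ε b) = if a = b then 1 else 0 := by
  split_ifs with h
  · subst h; simp
  · let e : (I → Bool) ≃ (I → Bool) :=
      Equiv.piCongrRight fun k => if k = a then Equiv.boolNot else Equiv.refl _
    have he : 𝔼 ε : I → Bool, boolSign (e ε a) * boolSign (e ε b) =
        𝔼 ε : I → Bool, boolSign (ε a) * boolSign (ε b) :=
      Fintype.expect_equiv e _ _ fun _ => rfl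
    have : ∀ ε, boolSign (e ε a) * boolSign (e ε b) = -(boolSign (ε a) * boolSign (ε b)) := by
      intro ε
      have h1 : e ε a = !ε a := by simp [e]
      have h2 : e ε b = ε b := by simp [e, Ne.symm h]
      rw [h1, h2]
      simp
    simp only [this, expect_neg_distrib] at he
    linarith

theorem expect_sq_sum_sign {I : Type*} [Fintype I] [DecidableEq I] (v : I → ℝ) :
    𝔼 ε : I → Bool, (∑ a, boolSign (ε a) * v a) ^ 2 = ∑ a, v a ^ 2 := by
  have : ∀ ε : I → Bool, (∑ a, boolSign (ε a) * v a) ^ 2 =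
      ∑ a, ∑ b, boolSign (ε a) * boolSign (ε b) * (v a * v b) := fun ε => by
    rw [sq, sum_mul_sum]
    exact sum_congr rfl fun a _ => sum_congr rfl fun b _ => by ring
  simp only [this, expect_sum_comm, ← expect_mul, expect_sign_mul_sign]
  simp [sq]

/-- The mean Euclidean norm of a Rademacher sum. -/
theorem expect_sqrt_sum_sq_le {I : Type*} [Fintype I] [DecidableEq I] {N : ℕ}
    (v : I → Fin N → ℝ) {r : ℝ} (hr : 0 ≤ r) (hv : ∀ a, ∑ j, v a j ^ 2 ≤ r ^ 2) :
    𝔼 ε : I → Bool, √(∑ j, (∑ a, boolSign (ε a) * v a j) ^ 2) ≤ r * √(Fintype.card I) := by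
  set X : (I → Bool) → ℝ := fun ε => √(∑ j, (∑ a, boolSign (ε a) * v a j) ^ 2) with hX
  set E := 𝔼 ε, X ε with hE
  have hsq : 𝔼 ε, X ε ^ 2 ≤ r ^ 2 * Fintype.card I := by
    have : ∀ ε, X ε ^ 2 = ∑ j, (∑ a, boolSign (ε a) * v a j) ^ 2 := fun ε =>
      Real.sq_sqrt (sum_nonneg fun j _ => sq_nonneg _)
    simp only [this, expect_sum_comm, expect_sq_sum_sign]
    rw [sum_comm]
    refine (sum_le_card_nsmul univ _ (r ^ 2) fun a _ => hv a).trans (le_of_eq ?_)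
    simp [mul_comm]
  -- Jensen's inequality for the square, in the form of a nonnegative variance.
  have hvar : E ^ 2 ≤ 𝔼 ε, X ε ^ 2 := by
    have h : 0 ≤ 𝔼 ε, (X ε - E) ^ 2 := expect_nonneg fun ε _ => sq_nonneg _
    have h' : 𝔼 ε, (X ε - E) ^ 2 = 𝔼 ε, X ε ^ 2 - E ^ 2 := by
      have : ∀ ε, (X ε - E) ^ 2 = X ε ^ 2 - 2 * E * X ε + E ^ 2 := fun ε => by ring
      simp only [this, expect_add_distrib, expect_sub_distrib, ← mul_expect,
        Fintype.expect_const, ← hE]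
      ring
    linarith
  refine (Real.le_sqrt_of_sq_le (hvar.trans hsq)).trans (le_of_eq ?_)
  rw [Real.sqrt_mul (sq_nonneg r), Real.sqrt_sq hr]

end SignAverages

/-! ### Symmetrization and uniform deviation for finite families -/

section UniformDeviation

open Finset ProbabilityTheory
open scoped BigOperators

variable {Z ι : Type*} [MeasurableSpace Z] [Finite ι] [Nonempty ι]

theorem BddMeas.apply_eval {m : ℕ} {f : Z → ℝ} (hf : BddMeas f) (i : Fin m) :
    BddMeas fun S : Fin m → Z => f (S i) :=
  hf.comp (measurable_pi_apply i)

theorem bddMeas_ciSup_deviation {f : ι → Z → ℝ} (hf : ∀ h, BddMeas (f h)) (a : ι → ℝ) (m : ℕ)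
    (A : ι → ℝ) : BddMeas fun S : Fin m → Z => ⨆ h, (A h + ∑ i, (a h - f h (S i))) :=
  BddMeas.iSup fun h => (BddMeas.const _).add
    (BddMeas.sum _ fun i => (BddMeas.const _).sub ((hf h).apply_eval i))

theorem bddMeas_expect_ciSup {f : ι → Z → ℝ} (hf : ∀ h, BddMeas (f h)) (m : ℕ) (A : ι → ℝ)
    (t : ℝ) : BddMeas fun S : Fin m → Z =>
      𝔼 σ : Fin m → Bool, ⨆ h, (A h + t * ∑ i, boolSign (σ i) * f h (S i)) :=
  BddMeas.expect fun _ => BddMeas.iSup fun h => (BddMeas.const _).add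
    ((BddMeas.sum _ fun i => ((hf h).apply_eval i).const_mul _).const_mul t)

/-- Symmetrization of one coordinate without a ghost sample. The expression under the supremum is
half of `A h + 2 * ∫ f h` plus half of `A h - 2 * f h z`. The supremum of the first is at most the
mean of the supremum of `A h + 2 * f h z`, so the two halves are the two values of the sign. -/
theorem integral_ciSup_sub_le (D : Measure Z) [IsProbabilityMeasure D] {f : ι → Z → ℝ}
    (hf : ∀ h, BddMeas (f h)) (A : ι → ℝ) :
    ∫ z, ⨆ h, (A h + ((∫ z', f h z' ∂D) - f h z)) ∂D ≤
      ∫ z, 𝔼 b, ⨆ h, (A h + 2 * (boolSign b * f h z)) ∂D := by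
  have hb : ∀ b, BddMeas fun z => ⨆ h, (A h + 2 * (boolSign b * f h z)) := fun b =>
    BddMeas.iSup fun h => (BddMeas.const _).add (((hf h).const_mul _).const_mul 2)
  have hmean : ∀ h, A h + 2 * ∫ z', f h z' ∂D ≤
      ∫ z, ⨆ h, (A h + 2 * (boolSign true * f h z)) ∂D := fun h => by
    have e : ∫ z, (A h + 2 * f h z) ∂D = A h + 2 * ∫ z', f h z' ∂D := by
      rw [integral_add (integrable_const _) (((hf h).const_mul 2).integrable D),
        integral_const_mul]
      simp
    rw [← e]
    refine integral_mono (((BddMeas.const _).add ((hf h).const_mul 2)).integrable D)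
      ((hb true).integrable D) fun z => ?_
    simpa using le_ciSup_of_finite (fun h => A h + 2 * (boolSign true * f h z)) h
  have hpt : ∀ z, ⨆ h, (A h + ((∫ z', f h z' ∂D) - f h z)) ≤
      ((∫ z, ⨆ h, (A h + 2 * (boolSign true * f h z)) ∂D) +
        ⨆ h, (A h + 2 * (boolSign false * f h z))) / 2 := fun z => ciSup_le fun h => by
    have h1 := hmean h
    have h2 := le_ciSup_of_finite (fun h => A h + 2 * (boolSign false * f h z)) h
    simp only [boolSign_false] at h2 ⊢
    linarith
  refine (integral_mono ((BddMeas.iSup fun h => (BddMeas.const _).add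
    ((BddMeas.const _).sub (hf h))).integrable D) ?_ hpt).trans (le_of_eq ?_)
  · exact (((integrable_const _).add ((hb false).integrable D)).div_const 2)
  · rw [integral_expect hb, expect_bool, integral_div,
      integral_add (integrable_const _) ((hb false).integrable D)]
    simp

/-- **Symmetrization**: the mean uniform deviation is at most twice the mean Rademacher
average. -/
theorem integral_ciSup_deviation_le (D : Measure Z) [IsProbabilityMeasure D] {f : ι → Z → ℝ}
    (hf : ∀ h, BddMeas (f h)) (m : ℕ) (A : ι → ℝ) :
    ∫ S, ⨆ h, (A h + ∑ i, ((∫ z', f h z' ∂D) - f h (S i))) ∂Measure.pi (fun _ : Fin m => D) ≤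
      ∫ S, 𝔼 σ : Fin m → Bool, ⨆ h, (A h + 2 * ∑ i, boolSign (σ i) * f h (S i))
        ∂Measure.pi (fun _ : Fin m => D) := by
  induction m generalizing A with
  | zero => simp
  | succ m ih =>
    have hdev := bddMeas_ciSup_deviation hf (fun h => ∫ z', f h z' ∂D) (m + 1) A
    have hrad := bddMeas_expect_ciSup hf (m + 1) A 2
    rw [integral_pi_fin_succ D hdev, integral_pi_fin_succ D hrad]
    -- The hybrid in which the first coordinate is still a deviation and the others are already
    -- symmetrized. After exchanging the integrals, `S` and `σ` are frozen into the offset and the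
    -- one-coordinate case applies.
    set Q : Z → (Fin m → Z) → ℝ := fun z S => 𝔼 σ : Fin m → Bool,
      ⨆ h, (A h + ((∫ z', f h z' ∂D) - f h z) + 2 * ∑ i, boolSign (σ i) * f h (S i)) with hQ
    have hQb : BddMeas fun p : Z × (Fin m → Z) => Q p.1 p.2 :=
      BddMeas.expect fun σ => BddMeas.iSup fun h => ((BddMeas.const _).add
        ((BddMeas.const _).sub ((hf h).comp measurable_fst))).add
        ((BddMeas.sum _ fun i => (((hf h).apply_eval i).comp measurable_snd).const_mul _).const_mul
          2)
    have h1 : ∀ z, ∫ S, ⨆ h, (A h + ∑ i, ((∫ z', f h z' ∂D) -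
        f h ((Fin.cons z S : Fin (m + 1) → Z) i))) ∂Measure.pi (fun _ : Fin m => D) ≤
        ∫ S, Q z S ∂Measure.pi (fun _ : Fin m => D) := fun z => by
      simpa only [Fin.sum_univ_succ, Fin.cons_zero, Fin.cons_succ, ← add_assoc] using
        ih fun h => A h + ((∫ z', f h z' ∂D) - f h z)
    refine (integral_mono ((BddMeas.integral_right hdev.fin_cons _).integrable D)
      ((BddMeas.integral_right hQb _).integrable D) h1).trans ?_
    rw [integral_integral_swap (hQb.integrable _)]
    rw [integral_integral_swap (f := fun z S => 𝔼 σ : Fin (m + 1) → Bool, ⨆ h, (A h +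
      2 * ∑ i, boolSign (σ i) * f h ((Fin.cons z S : Fin (m + 1) → Z) i)))
      (hrad.fin_cons.integrable _)]
    refine integral_mono ((BddMeas.integral_left hQb D).integrable _)
      ((BddMeas.integral_left hrad.fin_cons D).integrable _) fun S => ?_
    simp only [hQ, expect_fin_succ]
    have hQσ : ∀ σ : Fin m → Bool, BddMeas fun z =>
        ⨆ h, (A h + ((∫ z', f h z' ∂D) - f h z) + 2 * ∑ i, boolSign (σ i) * f h (S i)) := fun σ =>
      BddMeas.iSup fun h => ((BddMeas.const _).add ((BddMeas.const _).sub (hf h))).add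
        (BddMeas.const _)
    have hRσ : ∀ σ : Fin m → Bool, BddMeas fun z => 𝔼 b, ⨆ h, (A h + 2 * ∑ i : Fin (m + 1),
        boolSign ((Fin.cons b σ : Fin (m + 1) → Bool) i) *
          f h ((Fin.cons z S : Fin (m + 1) → Z) i)) := fun σ =>
      BddMeas.expect fun b => BddMeas.iSup fun h => (BddMeas.const _).add
        ((BddMeas.sum _ fun i => ((((hf h).apply_eval i).comp
          (measurable_fin_cons.comp measurable_prodMk_right)).const_mul _)).const_mul 2)
    rw [integral_expect hQσ]
    have hswap : ∀ z, (𝔼 b : Bool, 𝔼 σ : Fin m → Bool, ⨆ h, (A h + 2 * ∑ i : Fin (m + 1),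
        boolSign ((Fin.cons b σ : Fin (m + 1) → Bool) i) *
          f h ((Fin.cons z S : Fin (m + 1) → Z) i))) =
        𝔼 σ : Fin m → Bool, 𝔼 b : Bool, ⨆ h, (A h + 2 * ∑ i : Fin (m + 1),
        boolSign ((Fin.cons b σ : Fin (m + 1) → Bool) i) *
          f h ((Fin.cons z S : Fin (m + 1) → Z) i)) := fun z => expect_comm _ _ _
    simp only [hswap]
    rw [integral_expect hRσ]
    apply expect_le_expect
    intro σ _
    have := integral_ciSup_sub_le D hf fun h => A h + 2 * ∑ i, boolSign (σ i) * f h (S i)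
    simp only [Fin.sum_univ_succ, Fin.cons_zero, Fin.cons_succ, mul_add]
    simpa only [add_right_comm, add_assoc, add_left_comm, add_comm] using this

theorem ciSup_le_ciSup_add {a b : ι → ℝ} {C : ℝ} (h : ∀ i, a i ≤ b i + C) :
    ⨆ i, a i ≤ (⨆ i, b i) + C :=
  ciSup_le fun i => (h i).trans (add_le_add_left (le_ciSup_of_finite b i) C)

theorem sum_update_le {α : Type*} {m : ℕ} (φ : Fin m → α → ℝ) {C : ℝ}
    (hφ : ∀ i z z', φ i z ≤ φ i z' + C) (S : Fin m → α) (i : Fin m) (z : α) :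
    ∑ j, φ j (Function.update S i z j) ≤ ∑ j, φ j (S j) + C := by
  rw [← add_sum_erase _ _ (mem_univ i), ← add_sum_erase _ (fun j => φ j (S j)) (mem_univ i)]
  have : ∑ j ∈ univ.erase i, φ j (Function.update S i z j) = ∑ j ∈ univ.erase i, φ j (S j) :=
    sum_congr rfl fun j hj => by rw [Function.update_of_ne (ne_of_mem_erase hj)]
  rw [this, Function.update_self]
  linarith [hφ i z (S i)]

/-- One-sided uniform deviation of a finite family of functions with values in `[0, M]`, in terms
of its empirical Rademacher average. -/
theorem measureReal_exists_deviation_le (D : Measure Z) [IsProbabilityMeasure D] {f : ι → Z → ℝ}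
    (hf : ∀ h, Measurable (f h)) {M : ℝ} (hf0 : ∀ h z, 0 ≤ f h z) (hfM : ∀ h z, f h z ≤ M)
    {m : ℕ} (hm : 1 ≤ m) {δ : ℝ} (hδ : 0 < δ) (hδ1 : δ ≤ 1) :
    (Measure.pi fun _ : Fin m => D).real {S | ∃ h,
      ∑ i, f h (S i) + 2 * (𝔼 σ : Fin m → Bool, ⨆ h, ∑ i, boolSign (σ i) * f h (S i)) +
        m * (3 * M * √(Real.log (1 / δ) / (2 * m))) < m * ∫ z, f h z ∂D} ≤ δ := by
  have hfb : ∀ h, BddMeas (f h) := fun h => ⟨hf h, M, fun z => by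
    rw [abs_of_nonneg (hf0 h z)]; exact hfM h z⟩
  have hZ : Nonempty Z := nonempty_of_isProbabilityMeasure D
  obtain ⟨z₀⟩ := hZ
  have hM : 0 ≤ M := (hf0 (Classical.arbitrary ι) z₀).trans (hfM _ z₀)
  set P := Measure.pi fun _ : Fin m => D with hP
  have hm0 : (0 : ℝ) < m := by exact_mod_cast hm
  set G : (Fin m → Z) → ℝ := fun S => ⨆ h, ∑ i, ((∫ z, f h z ∂D) - f h (S i)) with hG
  set R : (Fin m → Z) → ℝ := fun S =>
    𝔼 σ : Fin m → Bool, ⨆ h, ∑ i, boolSign (σ i) * f h (S i) with hR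
  have hGb : BddMeas G := by
    simpa only [zero_add] using bddMeas_ciSup_deviation hfb (fun h => ∫ z', f h z' ∂D) m fun _ => 0
  have hRb : BddMeas R := by simpa using bddMeas_expect_ciSup hfb m 0 1
  have h2R : ∀ S, 𝔼 σ : Fin m → Bool, ⨆ h, ((0 : ℝ) + 2 * ∑ i, boolSign (σ i) * f h (S i)) =
      2 * R S := fun S => by
    simp only [hR, zero_add, mul_expect, Real.mul_iSup_of_nonneg zero_le_two]
  have hsymm : ∫ S, G S ∂P ≤ 2 * ∫ S, R S ∂P := by
    have := integral_ciSup_deviation_le D hfb m fun _ => 0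
    simp only [h2R, integral_const_mul] at this
    simpa only [zero_add] using this
  -- Concentrating `G - 2 * R` as a whole, rather than `G` and `R` separately, costs no split of
  -- `δ`. The bounded difference is `M + 2 * M`.
  set F : (Fin m → Z) → ℝ := fun S => G S - 2 * R S with hF
  have hFb : BddMeas F := hGb.sub (hRb.const_mul 2)
  have hFmean : ∫ S, F S ∂P ≤ 0 := by
    rw [hF, integral_sub (hGb.integrable P) ((hRb.const_mul 2).integrable P), integral_const_mul]
    linarith
  have hGd : ∀ S i z, G (Function.update S i z) ≤ G S + M := fun S i z =>
    ciSup_le_ciSup_add fun h => sum_update_le (fun _ z => (∫ z, f h z ∂D) - f h z)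
      (fun _ z z' => by linarith [hf0 h z, hfM h z']) S i z
  have hRd : ∀ S i z, R S ≤ R (Function.update S i z) + M := fun S i z => by
    have hσ : ∀ σ : Fin m → Bool, (⨆ h, ∑ j, boolSign (σ j) * f h (S j)) ≤
        (⨆ h, ∑ j, boolSign (σ j) * f h (Function.update S i z j)) + M := fun σ =>
      ciSup_le_ciSup_add fun h => by
        have := sum_update_le (fun j z => boolSign (σ j) * f h z) (C := M)
          (fun j z z' => by
            cases σ j <;> simp <;> linarith [hf0 h z, hfM h z', hf0 h z', hfM h z])
          (Function.update S i z) i (S i)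
        simpa using this
    have := expect_le_expect (s := univ) fun σ (_ : σ ∈ (univ : Finset (Fin m → Bool))) => hσ σ
    rwa [expect_add_distrib, Fintype.expect_const] at this
  have hmc := hasSubgaussianMGF_of_bounded_differences D (3 * M).toNNReal hFb fun S i z => by
    rw [Real.coe_toNNReal _ (by positivity)]
    simp only [hF]
    linarith [hGd S i z, hRd S i z]
  have hlog : 0 ≤ Real.log (1 / δ) := Real.log_nonneg (by rw [le_div_iff₀ hδ]; linarith)
  set s := √(Real.log (1 / δ) / (2 * m)) with hs
  have hss : s ^ 2 = Real.log (1 / δ) / (2 * m) := Real.sq_sqrt (by positivity)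
  -- For `M = 0` the variance proxy vanishes and the exponent of the tail bound would be a division
  -- by zero; all `f h` are then `0` and the event is empty.
  rcases hM.eq_or_lt with hM0 | hMpos
  · have hzero : ∀ h z, f h z = 0 := fun h z => le_antisymm ((hfM h z).trans hM0.ge) (hf0 h z)
    simp [hzero, ← hM0, hδ.le]
  have htail := hmc.measure_ge_le (ε := m * (3 * M * s)) (by positivity)
  have hexp : Real.exp (-(m * (3 * M * s)) ^ 2 /
      (2 * ((m * ((3 * M).toNNReal / 2) ^ 2 : NNReal) : ℝ))) = δ := by
    have : -(m * (3 * M * s)) ^ 2 / (2 * ((m * ((3 * M).toNNReal / 2) ^ 2 : NNReal) : ℝ)) =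
        Real.log δ := by
      push_cast
      rw [Real.coe_toNNReal _ (by positivity), mul_pow, mul_pow (3 * M), hss, one_div, Real.log_inv]
      field_simp
    rw [this, Real.exp_log hδ]
  rw [hexp] at htail
  refine (measureReal_mono ?_).trans htail
  rintro S ⟨h, hh⟩
  have hGh : m * (∫ z, f h z ∂D) - ∑ i, f h (S i) ≤ G S := by
    refine le_trans (le_of_eq ?_)
      (le_ciSup_of_finite (fun h => ∑ i, ((∫ z, f h z ∂D) - f h (S i))) h)
    simp
  simp only [Set.mem_ofPred_eq, hF]
  linarith

end UniformDeviation

/-! ### Margin losses: Lipschitz bounds and domination of the loss -/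

section MarginLoss

theorem maxLoss_nonneg {Y : Type*} {L : Y → Y → ℝ} (hL : IsDefiniteLoss L) : 0 ≤ maxLoss L :=
  Real.iSup_nonneg fun _ => hL.nonneg _ _

variable {Y : Type*} [Fintype Y]

/-- Includes the empty index set, where both suprema are `0`: this is the case of a single class. -/
theorem ciSup_le_ciSup_add_of_nonneg {ι : Type*} [Finite ι] {a b : ι → ℝ} {C : ℝ} (hC : 0 ≤ C)
    (h : ∀ i, a i ≤ b i + C) : ⨆ i, a i ≤ (⨆ i, b i) + C := by
  cases isEmpty_or_nonempty ι
  · simpa using hC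
  · exact ciSup_le_ciSup_add h

theorem clip_sub_clip_le {M r r' C : ℝ} (hC : 0 ≤ C) (h : r ≤ r' + C) :
    clip M r - clip M r' ≤ C := by
  simp only [clip]
  rcases min_cases M (max 0 r) with h1 | h1 <;> rcases min_cases M (max 0 r') with h2 | h2 <;>
    rcases max_cases 0 r with h3 | h3 <;> rcases max_cases 0 r' with h4 | h4 <;> linarith

theorem le_maxLoss (L : Y → Y → ℝ) (y y' : Y) : L y y' ≤ maxLoss L :=
  le_ciSup_of_finite (fun p : Y × Y => L p.1 p.2) (y, y')

theorem clip_nonneg {M r : ℝ} (hM : 0 ≤ M) : 0 ≤ clip M r := le_min hM (le_max_left _ _)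

theorem clip_le {M r : ℝ} : clip M r ≤ M := min_le_left _ _

/-- The additive margin loss of a vector of scores at the label `y`. -/
noncomputable def addMarginLoss (L : Y → Y → ℝ) (ρ : ℝ) (y : Y) (v : Y → ℝ) : ℝ :=
  clip (maxLoss L) (⨆ y' : {y' : Y // y' ≠ y}, (L y' y - (1 / ρ) * (v y - v y')))

/-- The multiplicative margin loss of a vector of scores at the label `y`. -/
noncomputable def multMarginLoss (L : Y → Y → ℝ) (ρ : ℝ) (y : Y) (v : Y → ℝ) : ℝ :=
  clip (maxLoss L) (⨆ y' : {y' : Y // y' ≠ y}, (L y' y * (1 - (1 / ρ) * (v y - v y'))))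

theorem sub_sub_sub_le_two_mul_norm (v v' : Y → ℝ) (y y' : Y) :
    (v' y - v' y') - (v y - v y') ≤ 2 * ‖v - v'‖ := by
  have h1 := abs_le.1 (norm_le_pi_norm (v - v') y)
  have h2 := abs_le.1 (norm_le_pi_norm (v - v') y')
  simp only [Pi.sub_apply] at h1 h2
  linarith [h1.1, h2.2]

theorem addMarginLoss_sub_le (L : Y → Y → ℝ) {ρ : ℝ} (hρ : 0 < ρ) (y : Y) (v v' : Y → ℝ) :
    addMarginLoss L ρ y v - addMarginLoss L ρ y v' ≤ 2 / ρ * ‖v - v'‖ := by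
  have hC : 0 ≤ 2 / ρ * ‖v - v'‖ := by positivity
  refine clip_sub_clip_le hC (ciSup_le_ciSup_add_of_nonneg hC fun y' => ?_)
  have := mul_le_mul_of_nonneg_left (sub_sub_sub_le_two_mul_norm v v' y y')
    (one_div_pos.2 hρ).le
  have e : 1 / ρ * (2 * ‖v - v'‖) = 2 / ρ * ‖v - v'‖ := by ring
  linarith

theorem multMarginLoss_sub_le {L : Y → Y → ℝ} (hL : IsDefiniteLoss L) {ρ : ℝ} (hρ : 0 < ρ)
    (y : Y) (v v' : Y → ℝ) :
    multMarginLoss L ρ y v - multMarginLoss L ρ y v' ≤ 2 * maxLoss L / ρ * ‖v - v'‖ := by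
  have hM := maxLoss_nonneg hL
  have hC : 0 ≤ 2 * maxLoss L / ρ * ‖v - v'‖ := by positivity
  refine clip_sub_clip_le hC (ciSup_le_ciSup_add_of_nonneg hC fun y' => ?_)
  have h1 := mul_le_mul_of_nonneg_left (sub_sub_sub_le_two_mul_norm v v' y y')
    (mul_nonneg (hL.nonneg y' y) (one_div_pos.2 hρ).le)
  have h2 := mul_le_mul_of_nonneg_right (le_maxLoss L y' y)
    (show 0 ≤ 1 / ρ * (2 * ‖v - v'‖) by positivity)
  have e : maxLoss L * (1 / ρ * (2 * ‖v - v'‖)) = 2 * maxLoss L / ρ * ‖v - v'‖ := by ring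
  linarith

/-- On the diagonal definiteness makes the loss `0`; off it, `k` is itself one of the competitors,
and truncation at `maxLoss L` never cuts below `L k y`. -/
theorem le_clip_ciSup {L : Y → Y → ℝ} (hL : IsDefiniteLoss L) (k y : Y)
    {a : {y' : Y // y' ≠ y} → ℝ} (h : ∀ hk : k ≠ y, L k y ≤ a ⟨k, hk⟩) :
    L k y ≤ clip (maxLoss L) (⨆ y', a y') := by
  by_cases hk : k = y
  · rw [(hL.eq_zero_iff k y).2 hk]
    exact clip_nonneg (maxLoss_nonneg hL)
  · exact le_min (le_maxLoss L k y)
      (((h hk).trans (le_ciSup_of_finite a ⟨k, hk⟩)).trans (le_max_right _ _))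

theorem loss_le_addMarginLoss {L : Y → Y → ℝ} (hL : IsDefiniteLoss L) {ρ : ℝ} (hρ : 0 < ρ)
    {v : Y → ℝ} {k : Y} (hk : ∀ y, v y ≤ v k) (y : Y) : L k y ≤ addMarginLoss L ρ y v := by
  refine le_clip_ciSup hL k y fun _ => ?_
  have := mul_nonneg (one_div_pos.2 hρ).le (sub_nonneg.2 (hk y))
  simp only
  linarith

theorem loss_le_multMarginLoss {L : Y → Y → ℝ} (hL : IsDefiniteLoss L) {ρ : ℝ} (hρ : 0 < ρ)
    {v : Y → ℝ} {k : Y} (hk : ∀ y, v y ≤ v k) (y : Y) : L k y ≤ multMarginLoss L ρ y v := by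
  refine le_clip_ciSup hL k y fun _ => le_mul_of_one_le_right (hL.nonneg k y) ?_
  have := mul_nonneg (one_div_pos.2 hρ).le (sub_nonneg.2 (hk y))
  linarith

end MarginLoss

/-! ### Generalization bounds for Lipschitz losses of linear scores -/

section LinearScores

open Finset
open scoped BigOperators

variable {X Y : Type*} {N : ℕ}

/-- The linear scores `w · Ψ(x, y)` of all the classes `y`. -/
def linScore (Ψ : X → Y → Fin N → ℝ) (w : Fin N → ℝ) (x : X) (y : Y) : ℝ := ∑ j, w j * Ψ x y j

theorem continuous_linScore (Ψ : X → Y → Fin N → ℝ) (x : X) :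
    Continuous fun w => linScore Ψ w x := by
  unfold linScore
  fun_prop

theorem measurable_linScore [MeasurableSpace X] {Ψ : X → Y → Fin N → ℝ} (hΨ : ∀ y, Measurable fun x => Ψ x y)
    (w : Fin N → ℝ) : Measurable (linScore Ψ w) :=
  measurable_pi_lambda _ fun y => Finset.measurable_fun_sum _ fun j _ =>
    ((measurable_pi_apply j).comp (hΨ y)).const_mul _

variable [Fintype Y]

theorem continuous_of_sub_le_mul_norm {φ : (Y → ℝ) → ℝ} {K : ℝ} (hK : 0 ≤ K)
    (hφ : ∀ v v', φ v - φ v' ≤ K * ‖v - v'‖) : Continuous φ := by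
  refine (LipschitzWith.of_dist_le_mul (K := K.toNNReal) fun v v' => ?_).continuous
  rw [Real.coe_toNNReal _ hK, Real.dist_eq, dist_eq_norm, abs_le]
  have := hφ v' v
  rw [norm_sub_rev] at this
  exact ⟨by linarith, hφ v v'⟩

theorem norm_le_expect_abs_sum [DecidableEq Y] (d : Y → ℝ) :
    ‖d‖ ≤ 𝔼 ε : Y → Bool, |∑ y, boolSign (ε y) * d y| :=
  (pi_norm_le_iff_of_nonneg (expect_nonneg fun _ _ => abs_nonneg _)).2 (abs_le_expect_abs_sum d)

theorem expect_ciSup_loss_le {ι : Type*} [Finite ι] [Nonempty ι] [DecidableEq Y]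
    (Ψ : X → Y → Fin N → ℝ) {φ : Y → (Y → ℝ) → ℝ} {K : ℝ} (hK : 0 ≤ K)
    (hφ : ∀ y v v', φ y v - φ y v' ≤ K * ‖v - v'‖) {m : ℕ} (S : Fin m → X × Y)
    (w : ι → Fin N → ℝ) :
    𝔼 σ : Fin m → Bool, ⨆ k, ∑ i, boolSign (σ i) * φ (S i).2 (linScore Ψ (w k) (S i).1) ≤
      K * 𝔼 ε : Fin m × Y → Bool,
        ⨆ k, ∑ a, boolSign (ε a) * linScore Ψ (w k) (S a.1).1 a.2 := by
  have := expect_ciSup_sum_sign_le (K := K) (fun i k => φ (S i).2 (linScore Ψ (w k) (S i).1))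
    (fun i y k => linScore Ψ (w k) (S i).1 y)
    (fun i k k' => (hφ _ _ _).trans (mul_le_mul_of_nonneg_left
      (norm_le_expect_abs_sum (linScore Ψ (w k) (S i).1 - linScore Ψ (w k') (S i).1)) hK))
    fun _ => 0
  simp only [zero_add] at this
  refine this.trans (le_of_eq ?_)
  rw [← expect_curry, mul_expect]
  simp only [Real.mul_iSup_of_nonneg hK, Fintype.sum_prod_type]

variable [MeasurableSpace X] [MeasurableSpace Y] [MeasurableSingletonClass Y]

theorem measurable_loss_linScore {Ψ : X → Y → Fin N → ℝ} (hΨ : ∀ y, Measurable fun x => Ψ x y)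
    {φ : Y → (Y → ℝ) → ℝ} (hφ : ∀ y, Continuous (φ y)) (w : Fin N → ℝ) :
    Measurable fun z : X × Y => φ z.2 (linScore Ψ w z.1) :=
  measurable_from_prod_countable_left fun y =>
    (hφ y).measurable.comp (measurable_linScore hΨ w)

/-- Uniform generalization bound for a Lipschitz loss of linear scores, with weights in a set `W`
whose empirical Rademacher complexity is at most `C`. -/
theorem exists_event_generalization (D : Measure (X × Y)) [IsProbabilityMeasure D] [DecidableEq Y]
    {Ψ : X → Y → Fin N → ℝ} (hΨ : ∀ y, Measurable fun x => Ψ x y)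
    {φ : Y → (Y → ℝ) → ℝ} {K M : ℝ} (hK : 0 ≤ K)
    (hφ : ∀ y v v', φ y v - φ y v' ≤ K * ‖v - v'‖) (hφ0 : ∀ y v, 0 ≤ φ y v)
    (hφM : ∀ y v, φ y v ≤ M) {m : ℕ} (hm : 1 ≤ m) (W : Set (Fin N → ℝ))
    {C : (Fin m → X × Y) → ℝ} (hC : Measurable C)
    (hW : ∀ S n (w : Fin (n + 1) → Fin N → ℝ), (∀ k, w k ∈ W) →
      𝔼 ε : Fin m × Y → Bool, (⨆ k, ∑ a, boolSign (ε a) * linScore Ψ (w k) (S a.1).1 a.2) ≤ C S)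
    {δ : ℝ} (hδ : 0 < δ) (hδ1 : δ ≤ 1) :
    ∃ E : Set (Fin m → X × Y), MeasurableSet E ∧
      Measure.pi (fun _ : Fin m => D) Eᶜ ≤ ENNReal.ofReal δ ∧
      ∀ S ∈ E, ∀ w ∈ W, m * ∫ z, φ z.2 (linScore Ψ w z.1) ∂D ≤
        ∑ i, φ (S i).2 (linScore Ψ w (S i).1) + 2 * (K * C S) +
          m * (3 * M * √(Real.log (1 / δ) / (2 * m))) := by
  rcases W.eq_empty_or_nonempty with rfl | hne
  · exact ⟨Set.univ, MeasurableSet.univ, by simp, by simp⟩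
  have := hne.to_subtype
  have hφc : ∀ y, Continuous (φ y) := fun y => continuous_of_sub_le_mul_norm hK (hφ y)
  have hmeas := measurable_loss_linScore hΨ hφc
  set F : (Fin N → ℝ) → X × Y → ℝ := fun w z => φ z.2 (linScore Ψ w z.1) with hF
  set c := m * (3 * M * √(Real.log (1 / δ) / (2 * m))) with hc
  have hFw : ∀ z, Continuous fun w => F w z := fun z =>
    (hφc z.2).comp (continuous_linScore Ψ z.1)
  have hIw : Continuous fun w => ∫ z, F w z ∂D :=
    continuous_of_dominated (bound := fun _ => M) (fun w => (hmeas w).aestronglyMeasurable)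
      (fun w => ae_of_all _ fun z => by
        rw [Real.norm_of_nonneg (hφ0 _ _)]; exact hφM _ _)
      (integrable_const M) (ae_of_all _ hFw)
  -- A countable dense set of weights makes the bad event a countable union of measurable sets. Each
  -- finite partial union has probability at most `δ`, because `C S` bounds the complexity of every
  -- finite subfamily whatever its size; continuity of the measure gives the same bound for the
  -- whole union.
  let w : ℕ → W := TopologicalSpace.denseSeq W
  set b : ℕ → Set (Fin m → X × Y) := fun k => {S | ∑ i, F (w k) (S i) + 2 * (K * C S) + c <
    m * ∫ z, F (w k) z ∂D} with hb
  have hbm : ∀ k, MeasurableSet (b k) := fun k =>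
    measurableSet_lt (((Finset.measurable_fun_sum _ fun i _ =>
      (hmeas _).comp (measurable_pi_apply i)).add ((hC.const_mul _).const_mul _)).add_const _)
      measurable_const
  refine ⟨(⋃ k, b k)ᶜ, (MeasurableSet.iUnion hbm).compl, ?_, fun S hS v hv => ?_⟩
  · rw [compl_compl, measure_iUnion_eq_iSup_accumulate]
    refine iSup_le fun n => ?_
    have hdev := measureReal_exists_deviation_le D (f := fun k : Fin (n + 1) => F (w k))
      (fun k => hmeas _) (fun _ _ => hφ0 _ _) (fun _ _ => hφM _ _) hm hδ hδ1
    rw [measureReal_def] at hdev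
    refine (measure_mono ?_).trans ((ENNReal.le_ofReal_iff_toReal_le (measure_ne_top _ _)
      hδ.le).2 hdev)
    intro S hS
    rw [Set.mem_accumulate] at hS
    obtain ⟨k, hk, hkS⟩ := hS
    refine ⟨⟨k, Nat.lt_succ_of_le hk⟩, lt_of_le_of_lt ?_ hkS⟩
    have h1 := expect_ciSup_loss_le Ψ hK hφ S fun k : Fin (n + 1) => (w k : Fin N → ℝ)
    have h2 := mul_le_mul_of_nonneg_left
      (hW S n (fun k => (w k : Fin N → ℝ)) fun k => (w k).2) hK
    have h3 := h1.trans h2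
    simp only [hF, ← hc]
    linarith
  -- Both sides of the inequality are continuous in the weight, so its validity passes from the
  -- dense sequence to all of `W`.
  · have hclosed : IsClosed {u : W | m * ∫ z, F u z ∂D ≤
        ∑ i, F u (S i) + 2 * (K * C S) + c} :=
      isClosed_le (continuous_const.mul (hIw.comp continuous_subtype_val))
        (((continuous_finsetSum _ fun i _ => (hFw (S i)).comp continuous_subtype_val).add
          continuous_const).add continuous_const)
    have hsub : Set.range w ⊆ {u : W | m * ∫ z, F u z ∂D ≤
        ∑ i, F u (S i) + 2 * (K * C S) + c} := by
      rintro _ ⟨k, rfl⟩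
      by_contra hk
      rw [Set.mem_ofPred_eq, not_le] at hk
      have hkS : S ∈ b k := hk
      exact hS (Set.mem_iUnion.2 ⟨k, hkS⟩)
    have := hclosed.closure_subset_iff.2 hsub
    rw [(TopologicalSpace.denseRange_denseSeq W).closure_range] at this
    exact this (Set.mem_univ (⟨v, hv⟩ : W))

theorem genError_le_integral (D : Measure (X × Y)) [IsProbabilityMeasure D] (L : Y → Y → ℝ)
    {g : X → Y} (hg : Measurable g) {F : X × Y → ℝ} (hF : Integrable F D)
    (h : ∀ z, L (g z.1) z.2 ≤ F z) : genError L D g ≤ ∫ z, F z ∂D := by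
  have hm : Measurable fun z : X × Y => L (g z.1) z.2 :=
    (Measurable.of_discrete (f := fun p : Y × Y => L p.1 p.2)).comp
      ((hg.comp measurable_fst).prodMk measurable_snd)
  obtain ⟨B, hB⟩ := (Set.finite_range fun p : Y × Y => |L p.1 p.2|).bddAbove
  exact integral_mono (Integrable.of_bound hm.aestronglyMeasurable B
    (ae_of_all _ fun z => hB ⟨(g z.1, z.2), rfl⟩)) hF h

theorem genError_le_of_mul_integral_le (D : Measure (X × Y)) [IsProbabilityMeasure D]
    {Ψ : X → Y → Fin N → ℝ} (hΨ : ∀ y, Measurable fun x => Ψ x y) (L : Y → Y → ℝ)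
    {φ : Y → (Y → ℝ) → ℝ} {K M B : ℝ} (hK : 0 ≤ K)
    (hφ : ∀ y v v', φ y v - φ y v' ≤ K * ‖v - v'‖) (hφ0 : ∀ y v, 0 ≤ φ y v)
    (hφM : ∀ y v, φ y v ≤ M) (hLφ : ∀ v k, (∀ y, v y ≤ v k) → ∀ y, L k y ≤ φ y v)
    {m : ℕ} (hm : 1 ≤ m) (S : Fin m → X × Y) {C : ℝ} {w : Fin N → ℝ} {g : X → Y}
    (hg : Measurable g) (hgw : IsPredictor (linScore Ψ w) g)
    (h : m * ∫ z, φ z.2 (linScore Ψ w z.1) ∂D ≤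
      ∑ i, φ (S i).2 (linScore Ψ w (S i).1) + 2 * (K * C) + m * B) :
    genError L D g ≤ 1 / (m : ℝ) * ∑ i, φ (S i).2 (linScore Ψ w (S i).1) +
      2 * K * (C / m) + B := by
  have hm0 : (0 : ℝ) < m := by exact_mod_cast hm
  have hb : BddMeas fun z : X × Y => φ z.2 (linScore Ψ w z.1) :=
    ⟨measurable_loss_linScore hΨ (fun y => continuous_of_sub_le_mul_norm hK (hφ y)) w, M,
      fun z => by rw [abs_of_nonneg (hφ0 _ _)]; exact hφM _ _⟩
  refine (genError_le_integral D L hg (hb.integrable D) fun z => hLφ _ _ (hgw z.1) z.2).trans ?_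
  refine le_of_mul_le_mul_left (h.trans (le_of_eq ?_)) hm0
  field_simp

theorem holdsWithProb_margin_bounds (D : Measure (X × Y)) [IsProbabilityMeasure D]
    [DecidableEq Y] {L : Y → Y → ℝ} (hL : IsDefiniteLoss L)
    {Ψ : X → Y → Fin N → ℝ} (hΨ : ∀ y, Measurable fun x => Ψ x y)
    {m : ℕ} (hm : 1 ≤ m) {ρ : ℝ} (hρ : 0 < ρ) (W : Set (Fin N → ℝ))
    {C : (Fin m → X × Y) → ℝ} (hC : Measurable C)
    (hW : ∀ S n (w : Fin (n + 1) → Fin N → ℝ), (∀ k, w k ∈ W) →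
      𝔼 ε : Fin m × Y → Bool, (⨆ k, ∑ a, boolSign (ε a) * linScore Ψ (w k) (S a.1).1 a.2) ≤ C S)
    {δ : ℝ} (hδ : 0 < δ) :
    HoldsWithProb D m δ fun S => ∀ w ∈ W, ∀ g : X → Y, Measurable g →
      IsPredictor (linScore Ψ w) g →
        genError L D g ≤ empAddMarginLoss L ρ S (linScore Ψ w) + 2 * (2 / ρ) * (C S / m) +
          3 * maxLoss L * √(Real.log (2 / δ) / (2 * (m : ℝ))) ∧
        genError L D g ≤ empMultMarginLoss L ρ S (linScore Ψ w) +
          2 * (2 * maxLoss L / ρ) * (C S / m) +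
          3 * maxLoss L * √(Real.log (2 / δ) / (2 * (m : ℝ))) := by
  rcases le_or_gt 1 δ with hδ1 | hδ1
  -- For `1 ≤ δ` the required probability is at most `0`, so the empty event suffices.
  · exact ⟨∅, MeasurableSet.empty, by simp [ENNReal.ofReal_eq_zero.2 (sub_nonpos.2 hδ1)], by simp⟩
  have hM := maxLoss_nonneg hL
  have hK₁ : 0 ≤ 2 / ρ := by positivity
  have hK₂ : 0 ≤ 2 * maxLoss L / ρ := by positivity
  obtain ⟨E₁, hE₁, hP₁, hb₁⟩ := exists_event_generalization D hΨ hK₁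
    (addMarginLoss_sub_le L hρ) (fun _ _ => clip_nonneg hM) (fun _ _ => clip_le) hm W hC hW
    (half_pos hδ) (by linarith)
  obtain ⟨E₂, hE₂, hP₂, hb₂⟩ := exists_event_generalization D hΨ hK₂
    (multMarginLoss_sub_le hL hρ) (fun _ _ => clip_nonneg hM) (fun _ _ => clip_le) hm W hC hW
    (half_pos hδ) (by linarith)
  have hδ2 : 1 / (δ / 2) = 2 / δ := by rw [one_div_div]
  rw [hδ2] at hb₁ hb₂
  refine ⟨E₁ ∩ E₂, hE₁.inter hE₂, ?_, fun S hS w hw g hg hgw => ⟨?_, ?_⟩⟩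
  · have hcompl : Measure.pi (fun _ : Fin m => D) (E₁ ∩ E₂)ᶜ ≤ ENNReal.ofReal δ := by
      rw [Set.compl_inter, show δ = δ / 2 + δ / 2 by ring,
        ENNReal.ofReal_add (half_pos hδ).le (half_pos hδ).le]
      exact (measure_union_le _ _).trans (add_le_add hP₁ hP₂)
    rw [ENNReal.ofReal_sub _ hδ.le, ENNReal.ofReal_one, tsub_le_iff_right]
    rw [← prob_add_prob_compl (μ := Measure.pi fun _ : Fin m => D) (hE₁.inter hE₂)]
    exact add_le_add_right hcompl _
  · exact genError_le_of_mul_integral_le D hΨ L hK₁ (addMarginLoss_sub_le L hρ)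
      (fun _ _ => clip_nonneg hM) (fun _ _ => clip_le)
      (fun _ _ hk => loss_le_addMarginLoss hL hρ hk) hm S hg hgw (hb₁ S hS.1 w hw)
  · exact genError_le_of_mul_integral_le D hΨ L hK₂ (multMarginLoss_sub_le hL hρ)
      (fun _ _ => clip_nonneg hM) (fun _ _ => clip_le)
      (fun _ _ hk => loss_le_multMarginLoss hL hρ hk) hm S hg hgw (hb₂ S hS.2 w hw)

end LinearScores

/-! ### Rademacher complexity of norm-bounded linear scores -/

section Complexity

open Finset
open scoped BigOperators

variable {X Y : Type*} {N m : ℕ}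

theorem featRadius_nonneg (Ψ : X → Y → Fin N → ℝ) (q : ℝ≥0∞) [Fact (1 ≤ q)]
    (S : Fin m → X × Y) : 0 ≤ featRadius Ψ q S :=
  Real.iSup_nonneg fun k => norm_nonneg (WithLp.toLp q (Ψ (S k.1).1 k.2))

/-- Collects the signs into one vector paired with `w`, so that Hölder or Cauchy–Schwarz separates
the weights from the randomness. -/
theorem sum_mul_linScore {I : Type*} [Fintype I] (s : I → ℝ) (Ψ : X → Y → Fin N → ℝ)
    (w : Fin N → ℝ) (x : I → X) (y : I → Y) :
    ∑ a, s a * linScore Ψ w (x a) (y a) = ∑ j, w j * ∑ a, s a * Ψ (x a) (y a) j := by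
  simp only [linScore, mul_sum]
  rw [sum_comm]
  exact sum_congr rfl fun j _ => sum_congr rfl fun a _ => by ring

variable [Fintype Y]

theorem le_featRadius (Ψ : X → Y → Fin N → ℝ) (q : ℝ≥0∞) (S : Fin m → X × Y) (a : Fin m × Y) :
    ‖WithLp.toLp q (Ψ (S a.1).1 a.2)‖ ≤ featRadius Ψ q S :=
  le_ciSup_of_finite (fun k : Fin m × Y => ‖WithLp.toLp q (Ψ (S k.1).1 k.2)‖) a

theorem measurable_featRadius [MeasurableSpace X] [MeasurableSpace Y] {Ψ : X → Y → Fin N → ℝ}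
    (hΨ : ∀ y, Measurable fun x => Ψ x y) (q : ℝ≥0∞) [Fact (1 ≤ q)] :
    Measurable (featRadius Ψ q : (Fin m → X × Y) → ℝ) :=
  Measurable.iSup fun k => (PiLp.continuous_toLp q _).norm.measurable.comp
    ((hΨ k.2).comp (measurable_fst.comp (measurable_pi_apply k.1)))

variable [DecidableEq Y]

/-- Rademacher complexity of the linear scores with `ℓ¹`-bounded weights. -/
theorem expect_ciSup_linScore_le_of_l1 {ι : Type*} [Finite ι] [Nonempty ι]
    (Ψ : X → Y → Fin N → ℝ) {Λ : ℝ} (S : Fin m → X × Y) (w : ι → Fin N → ℝ)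
    (hw : ∀ k, ‖WithLp.toLp 1 (w k)‖ ≤ Λ) :
    𝔼 ε : Fin m × Y → Bool, (⨆ k, ∑ a, boolSign (ε a) * linScore Ψ (w k) (S a.1).1 a.2) ≤
      Λ * featRadius Ψ ∞ S * √(2 * (m * Fintype.card Y) * Real.log (2 * N)) := by
  obtain ⟨k₀⟩ := ‹Nonempty ι›
  have hΛ : 0 ≤ Λ := (norm_nonneg (WithLp.toLp 1 (w k₀))).trans (hw k₀)
  have hr := featRadius_nonneg Ψ ∞ S
  have hw1 : ∀ k, ∑ j, |w k j| ≤ Λ := fun k =>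
    (PiLp.norm_eq_of_L1 (WithLp.toLp 1 (w k))).symm.le.trans (hw k)
  -- Massart's lemma needs `0 < N`. For `N = 0` all scores vanish.
  rcases Nat.eq_zero_or_pos N with rfl | hN
  · simp [linScore]
  have : Nonempty (Fin N) := ⟨⟨0, hN⟩⟩
  have := expect_le_sqrt_of_abs_le (fun (a : Fin m × Y) j => Λ * Ψ (S a.1).1 a.2 j)
    (mul_nonneg hΛ hr) (fun a j => by
      rw [abs_mul, abs_of_nonneg hΛ]
      exact mul_le_mul_of_nonneg_left
        ((PiLp.norm_apply_le (WithLp.toLp ∞ (Ψ (S a.1).1 a.2)) j).trans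
          (le_featRadius Ψ ∞ S a)) hΛ) hN
    (fun ε => ⨆ k, ∑ a, boolSign (ε a) * linScore Ψ (w k) (S a.1).1 a.2) fun ε => by
      -- The coordinate attaining the sup norm of the signed feature sum; Hölder's inequality then
      -- bounds every weight `w k` by this one coordinate.
      obtain ⟨j, hj⟩ := Finite.exists_max fun j => |∑ a, boolSign (ε a) * Ψ (S a.1).1 a.2 j|
      have : Nonempty ι := ⟨k₀⟩
      refine ⟨j, ciSup_le fun k => ?_⟩
      have e : ∑ a, boolSign (ε a) * (Λ * Ψ (S a.1).1 a.2 j) =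
          Λ * ∑ a, boolSign (ε a) * Ψ (S a.1).1 a.2 j := by
        rw [mul_sum]
        exact sum_congr rfl fun a _ => by ring
      rw [e, abs_mul, abs_of_nonneg hΛ, sum_mul_linScore]
      calc _ ≤ ∑ j', |w k j'| * |∑ a, boolSign (ε a) * Ψ (S a.1).1 a.2 j| :=
            sum_le_sum fun j' _ => (le_abs_self _).trans (by
              rw [abs_mul]
              exact mul_le_mul_of_nonneg_left (hj j') (abs_nonneg _))
        _ ≤ _ := by
            rw [← sum_mul]
            exact mul_le_mul_of_nonneg_right (hw1 k) (abs_nonneg _)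
  simpa using this

/-- Rademacher complexity of the linear scores with `ℓ²`-bounded weights. -/
theorem expect_ciSup_linScore_le_of_l2 {ι : Type*} [Finite ι] [Nonempty ι]
    (Ψ : X → Y → Fin N → ℝ) {Λ : ℝ} (S : Fin m → X × Y) (w : ι → Fin N → ℝ)
    (hw : ∀ k, ‖WithLp.toLp 2 (w k)‖ ≤ Λ) :
    𝔼 ε : Fin m × Y → Bool, (⨆ k, ∑ a, boolSign (ε a) * linScore Ψ (w k) (S a.1).1 a.2) ≤
      Λ * featRadius Ψ 2 S * √(m * Fintype.card Y) := by
  obtain ⟨k₀⟩ := id ‹Nonempty ι›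
  have hΛ : 0 ≤ Λ := (norm_nonneg (WithLp.toLp 2 (w k₀))).trans (hw k₀)
  have hr := featRadius_nonneg Ψ 2 S
  have hnorm : ∀ v : Fin N → ℝ, √(∑ j, v j ^ 2) = ‖WithLp.toLp 2 v‖ := fun v => by
    simp [EuclideanSpace.norm_eq]
  have h1 : ∀ ε : Fin m × Y → Bool,
      (⨆ k, ∑ a, boolSign (ε a) * linScore Ψ (w k) (S a.1).1 a.2) ≤
        Λ * √(∑ j, (∑ a, boolSign (ε a) * Ψ (S a.1).1 a.2 j) ^ 2) := fun ε =>
    ciSup_le fun k => by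
      rw [sum_mul_linScore]
      refine (Real.sum_mul_le_sqrt_mul_sqrt _ _ _).trans ?_
      rw [hnorm]
      exact mul_le_mul_of_nonneg_right (hw k) (Real.sqrt_nonneg _)
  have h2 := expect_sqrt_sum_sq_le (fun (a : Fin m × Y) j => Ψ (S a.1).1 a.2 j) hr fun a => by
    rw [← Real.sqrt_le_left hr, hnorm]
    exact le_featRadius Ψ 2 S a
  have h3 := expect_le_expect (s := univ) fun ε (_ : ε ∈ (univ : Finset (Fin m × Y → Bool))) =>
    h1 ε
  rw [← mul_expect] at h3
  refine (h3.trans (mul_le_mul_of_nonneg_left h2 hΛ)).trans (le_of_eq ?_)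
  simp [mul_assoc]

end Complexity

theorem sqrt_mul_div_self {m : ℝ} (hm : 0 < m) (a : ℝ) : √(m * a) / m = √(a / m) := by
  have : a / m = m * a / m ^ 2 := by field_simp
  rw [this, Real.sqrt_div' _ (sq_nonneg m), Real.sqrt_sq hm.le]

theorem corollary10 {X Y : Type*} [MeasurableSpace X] [Fintype Y] [MeasurableSpace Y]
    [MeasurableSingletonClass Y]
    (D : Measure (X × Y)) [IsProbabilityMeasure D]
    (L : Y → Y → ℝ) (hL : IsDefiniteLoss L)
    {N : ℕ} (Ψ : X → Y → Fin N → ℝ) (hΨ : ∀ y, Measurable fun x => Ψ x y)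
    (Λ₁ Λ₂ : ℝ) (m : ℕ) (hm : 1 ≤ m) (ρ : ℝ) (hρ : 0 < ρ) :
    (∀ δ : ℝ, 0 < δ → HoldsWithProb D m δ fun S =>
      ∀ h ∈ linHyp Ψ 1 Λ₁, ∀ g : X → Y, Measurable g → IsPredictor h g →
        genError L D g ≤ empAddMarginLoss L ρ S h
          + 4 * √2 * Λ₁ * featRadius Ψ ∞ S / ρ
            * √((Fintype.card Y : ℝ) * Real.log (2 * (N : ℝ)) / (m : ℝ))
          + 3 * maxLoss L * √(Real.log (2 / δ) / (2 * (m : ℝ))) ∧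
        genError L D g ≤ empMultMarginLoss L ρ S h
          + 4 * √2 * maxLoss L * Λ₁ * featRadius Ψ ∞ S / ρ
            * √((Fintype.card Y : ℝ) * Real.log (2 * (N : ℝ)) / (m : ℝ))
          + 3 * maxLoss L * √(Real.log (2 / δ) / (2 * (m : ℝ)))) ∧
    (∀ δ : ℝ, 0 < δ → HoldsWithProb D m δ fun S =>
      ∀ h ∈ linHyp Ψ 2 Λ₂, ∀ g : X → Y, Measurable g → IsPredictor h g →
        genError L D g ≤ empAddMarginLoss L ρ S h
          + 4 * √2 * Λ₂ * featRadius Ψ 2 S / ρ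
            * √((Fintype.card Y : ℝ) / (m : ℝ))
          + 3 * maxLoss L * √(Real.log (2 / δ) / (2 * (m : ℝ))) ∧
        genError L D g ≤ empMultMarginLoss L ρ S h
          + 4 * √2 * maxLoss L * Λ₂ * featRadius Ψ 2 S / ρ
            * √((Fintype.card Y : ℝ) / (m : ℝ))
          + 3 * maxLoss L * √(Real.log (2 / δ) / (2 * (m : ℝ)))) := by
  classical
  have hM := maxLoss_nonneg hL
  have hm0 : (0 : ℝ) < m := by exact_mod_cast hm
  constructor
  · intro δ hδ
    obtain ⟨E, hE, hP, hb⟩ := holdsWithProb_margin_bounds D hL hΨ hm hρ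
      {w | ‖WithLp.toLp 1 w‖ ≤ Λ₁}
      (((measurable_featRadius hΨ ∞).const_mul Λ₁).mul_const
        √(2 * (m * Fintype.card Y) * Real.log (2 * N)))
      (fun S n w hw => expect_ciSup_linScore_le_of_l1 Ψ S w hw) hδ
    refine ⟨E, hE, hP, ?_⟩
    rintro S hS _ ⟨w, hw, rfl⟩ g hg hgw
    obtain ⟨h1, h2⟩ := hb S hS w hw g hg hgw
    -- The `√2` of the final constant is the one from Massart's lemma; the remaining `4` is `2` from
    -- symmetrization times `2` from the Lipschitz constant.
    have e : √(2 * (m * Fintype.card Y) * Real.log (2 * N)) / m =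
        √2 * √(Fintype.card Y * Real.log (2 * N) / m) := by
      rw [← sqrt_mul_div_self hm0, ← mul_div_assoc, ← Real.sqrt_mul zero_le_two]
      congr 2
      ring
    rw [mul_div_assoc (Λ₁ * featRadius Ψ ∞ S), e] at h1 h2
    refine ⟨h1.trans (le_of_eq ?_), h2.trans (le_of_eq ?_)⟩
    · congr 2
      ring
    · congr 2
      ring
  · intro δ hδ
    obtain ⟨E, hE, hP, hb⟩ := holdsWithProb_margin_bounds D hL hΨ hm hρ
      {w | ‖WithLp.toLp 2 w‖ ≤ Λ₂}
      (((measurable_featRadius hΨ 2).const_mul Λ₂).mul_const √(m * Fintype.card Y))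
      (fun S n w hw => expect_ciSup_linScore_le_of_l2 Ψ S w hw) hδ
    refine ⟨E, hE, hP, ?_⟩
    rintro S hS _ ⟨w, hw, rfl⟩ g hg hgw
    obtain ⟨h1, h2⟩ := hb S hS w hw g hg hgw
    rw [mul_div_assoc (Λ₂ * featRadius Ψ 2 S), sqrt_mul_div_self hm0] at h1 h2
    have hΛ : 0 ≤ Λ₂ := (norm_nonneg (WithLp.toLp 2 w)).trans hw
    have hr := featRadius_nonneg Ψ 2 S
    -- The Euclidean argument already gives the constant `4`; the factor `√2` is slack here.
    have hsqrt : (1 : ℝ) ≤ √2 := Real.one_le_sqrt.2 one_le_two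
    have hadd : 2 * (2 / ρ) * (Λ₂ * featRadius Ψ 2 S * √(Fintype.card Y / m)) ≤
        4 * √2 * Λ₂ * featRadius Ψ 2 S / ρ * √(Fintype.card Y / m) := by
      refine (le_mul_of_one_le_right (by positivity) hsqrt).trans (le_of_eq ?_)
      ring
    have hmult : 2 * (2 * maxLoss L / ρ) * (Λ₂ * featRadius Ψ 2 S * √(Fintype.card Y / m)) ≤
        4 * √2 * maxLoss L * Λ₂ * featRadius Ψ 2 S / ρ * √(Fintype.card Y / m) := by
      refine (le_mul_of_one_le_right (by positivity) hsqrt).trans (le_of_eq ?_)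
      ring
    exact ⟨h1.trans (add_le_add_left (add_le_add_right hadd _) _),
      h2.trans (add_le_add_left (add_le_add_right hmult _) _)⟩
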